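/- All Banach algebras are complex and need not have an identity. Let $\Omega$ be a locally compact Hausdorff space, and let $\mathcal U=\{\Omega,(A_t)_{t\in\Omega},\Theta\}$ be a continuous field of non-zero Banach algebras over $\Omega$: each $A_t$ is a non-zero Banach algebra and $\Theta$ is a subalgebra of $\prod_{t\in\Omega}A_t$ such that (i) $\{x(t):x\in\Theta\}$ is dense in $A_t$ for every $t$; (ii) $t\mapsto\|x(t)\|$ is continuous for every $x\in\Theta$; (iii) if $x\in\prod_t A_t$ and for every $t_0\in\Omega$ and $\varepsilon>0$ there is $x'\in\Theta$ with $\|x(t)-x'(t)\|\le\varepsilon$ for all $t$ in a neighbourhood of $t_0$, then $x\in\Theta$. For $Y\subseteq\Omega$ let $\mathcal U|_Y$ be the induced field over $Y$, whose continuous vector fields are the $x\in\prod_{t\in Y}A_t$ that near every point of $Y$ can be uniformly approximated by members of $\Theta$ in the same sense. A field over a space $X$ is trivial if, through a family of isometric algebra isomorphisms of the fibres, it is isomorphic to the field of all continuous functions from $X$ to some fixed Banach algebra. A field $\mathcal V$ over $X$ is $\sigma$-locally trivial if there are an open cover $\mathcal C$ of $X$ such that $\mathcal V|_U$ is trivial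 for each $U\in\mathcal C$, and a countable open cover $\{V_j\}$ of $X$ such that each closure $\overline{V_j}$ (in $X$) is contained in some member of $\mathcal C$. Suppose that $\Omega$ is the disjoint union of a family of open subsets $(W_\mu)_{\mu\in\mathcal M}$ such that each $\mathcal U|_{W_\mu}$ is $\sigma$-locally trivial. Let $\mathfrak A$ be the Banach algebra of all $x\in\Theta$ such that $\|x(t)\|$ vanishes at infinity on $\Omega$, with the norm $\|x\|=\sup_{t\in\Omega}\|x(t)\|$. Suppose that $\mathfrak A$ is left projective or right projective; that is, for $P=\mathfrak A$ as a left (respectively right) Banach $\mathfrak A$-module, every morphism $\varphi:Y\to P$ of left (right) Banach $\mathfrak A$-modules that has a bounded linear right inverse has a right inverse that is a morphism of left (right) Banach $\mathfrak A$-modules. Then $\Omega$ is paracompact. -/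

import Mathlib

open Filter Topology
open scoped ENNReal

universe u v w w'

section Modules

/-- A left Banach module structure on the complex Banach space `X` over the (not necessarily unital)
complex Banach algebra `A`: a bounded bilinear outer multiplication `act a x = a · x` with
`(a b) · x = a · (b · x)`. -/
structure LeftBanachModule (A : Type w) (X : Type w') [NonUnitalNormedRing A] [NormedSpace ℂ A]
    [NormedAddCommGroup X] [NormedSpace ℂ X] where
  act : A →L[ℂ] X →L[ℂ] X
  mul_act : ∀ (a b : A) (x : X), act (a * b) x = act a (act b x)

/-- A right Banach module structure: `act a x = x · a`, with `x · (a b) = (x · a) · b`. -/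
structure RightBanachModule (A : Type w) (X : Type w') [NonUnitalNormedRing A] [NormedSpace ℂ A]
    [NormedAddCommGroup X] [NormedSpace ℂ X] where
  act : A →L[ℂ] X →L[ℂ] X
  mul_act : ∀ (a b : A) (x : X), act (a * b) x = act b (act a x)

/-- The left Banach module `P` is projective: every morphism `φ : Y → P` of left Banach modules
that has a right inverse among the bounded linear operators (and so is an epimorphism) has a right
inverse among the morphisms of left Banach modules. -/
def LeftBanachModule.IsProjective {A : Type w} {P : Type w'} [NonUnitalNormedRing A]
    [NormedSpace ℂ A] [NormedAddCommGroup P] [NormedSpace ℂ P] (N : LeftBanachModule A P) : Prop :=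
  ∀ (Y : Type (max w w')) [NormedAddCommGroup Y] [NormedSpace ℂ Y] [CompleteSpace Y]
    (M : LeftBanachModule A Y) (φ : Y →L[ℂ] P),
    (∀ (a : A) (y : Y), φ (M.act a y) = N.act a (φ y)) →
    (∃ σ : P →L[ℂ] Y, ∀ x, φ (σ x) = x) →
    ∃ ψ : P →L[ℂ] Y, (∀ (a : A) (x : P), ψ (N.act a x) = M.act a (ψ x)) ∧ ∀ x, φ (ψ x) = x

/-- The right Banach module `P` is projective. -/
def RightBanachModule.IsProjective {A : Type w} {P : Type w'} [NonUnitalNormedRing A]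
    [NormedSpace ℂ A] [NormedAddCommGroup P] [NormedSpace ℂ P] (N : RightBanachModule A P) : Prop :=
  ∀ (Y : Type (max w w')) [NormedAddCommGroup Y] [NormedSpace ℂ Y] [CompleteSpace Y]
    (M : RightBanachModule A Y) (φ : Y →L[ℂ] P),
    (∀ (a : A) (y : Y), φ (M.act a y) = N.act a (φ y)) →
    (∃ σ : P →L[ℂ] Y, ∀ x, φ (σ x) = x) →
    ∃ ψ : P →L[ℂ] Y, (∀ (a : A) (x : P), ψ (N.act a x) = M.act a (ψ x)) ∧ ∀ x, φ (ψ x) = x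

variable (A : Type w) [NonUnitalNormedRing A] [NormedSpace ℂ A] [IsScalarTower ℂ A A]
  [SMulCommClass ℂ A A]

/-- `A` as a left module over itself. -/
noncomputable def LeftBanachModule.self : LeftBanachModule A A where
  act := ContinuousLinearMap.mul ℂ A
  mul_act a b x := mul_assoc a b x

/-- `A` as a right module over itself. -/
noncomputable def RightBanachModule.self : RightBanachModule A A where
  act := (ContinuousLinearMap.mul ℂ A).flip
  mul_act a b x := (mul_assoc x a b).symm

/-- A Banach algebra is left projective if it is projective as a left Banach module over itself. -/
def IsLeftProjective [CompleteSpace A] : Prop := (LeftBanachModule.self A).IsProjective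

/-- A Banach algebra is right projective if it is projective as a right Banach module over
itself. -/
def IsRightProjective [CompleteSpace A] : Prop := (RightBanachModule.self A).IsProjective

end Modules

section Fields

variable {Ω : Type u} [TopologicalSpace Ω] {A : Ω → Type v} [∀ t, NonUnitalNormedRing (A t)]
  [∀ t, NormedSpace ℂ (A t)]

/-- A continuous field of (complex, not necessarily unital) Banach algebras over `Ω` with fibres
`A t`: a subalgebra `Θ` of `∏ t, A t` with the three axioms below. The fibres are required to be
complete, and `Ω` to be locally compact Hausdorff, where the notion is used. -/
structure ContinuousField {Ω : Type u} [TopologicalSpace Ω] (A : Ω → Type v)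
    [∀ t, NonUnitalNormedRing (A t)] [∀ t, NormedSpace ℂ (A t)] where
  Θ : NonUnitalSubalgebra ℂ (∀ t, A t)
  dense : ∀ t, Dense {a : A t | ∃ x ∈ Θ, x t = a}
  continuous_norm : ∀ x ∈ Θ, Continuous fun t => ‖x t‖
  locally_closed : ∀ x : ∀ t, A t,
    (∀ t₀, ∀ ε > 0, ∃ x' ∈ Θ, ∀ᶠ t in 𝓝 t₀, ‖x t - x' t‖ ≤ ε) → x ∈ Θ

namespace ContinuousField

/-- The constant field over `Ω` defined by the Banach algebra `B`. -/
def const (Ω : Type u) [TopologicalSpace Ω] (B : Type v) [NonUnitalNormedRing B]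
    [NormedSpace ℂ B] [IsScalarTower ℂ B B] [SMulCommClass ℂ B B] :
    ContinuousField (fun _ : Ω => B) where
  Θ :=
    { carrier := {x | Continuous x}
      add_mem' := fun ha hb => Continuous.add ha hb
      zero_mem' := continuous_const
      mul_mem' := fun ha hb => Continuous.mul ha hb
      smul_mem' := fun c _ hx => Continuous.const_smul hx c }
  dense t := dense_univ.mono fun a _ => ⟨fun _ => a, continuous_const, rfl⟩
  continuous_norm x hx := Continuous.norm hx
  locally_closed x hx := by
    refine continuous_of_locally_uniform_approx_of_continuousAt fun t₀ V hV => ?_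
    obtain ⟨ε, hε, hV⟩ := Metric.mem_uniformity_dist.1 hV
    obtain ⟨x', hx', h⟩ := hx t₀ (ε / 2) (half_pos hε)
    refine ⟨_, h, x', Continuous.continuousAt hx', fun t ht => hV ?_⟩
    rw [dist_eq_norm]
    exact lt_of_le_of_lt ht (half_lt_self hε)

/-- The field induced on a subset `Y` of `Ω`: its continuous vector fields are the vector fields
over `Y` that, near every point of `Y`, are uniformly approximated by members of `Θ`. -/
def restrict (𝒰 : ContinuousField A) (Y : Set Ω) : ContinuousField (fun t : Y => A t) where
  Θ :=
    { carrier := {x | ∀ t₀ : Y, ∀ ε > 0, ∃ x' ∈ 𝒰.Θ, ∀ᶠ t : Y in 𝓝 t₀, ‖x t - x' t‖ ≤ ε}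
      zero_mem' := fun t₀ ε hε => ⟨0, zero_mem _, by simpa using hε.le⟩
      add_mem' := by
        intro x y hx hy t₀ ε hε
        obtain ⟨x', hx', h1⟩ := hx t₀ (ε / 2) (half_pos hε)
        obtain ⟨y', hy', h2⟩ := hy t₀ (ε / 2) (half_pos hε)
        refine ⟨x' + y', add_mem hx' hy', ?_⟩
        filter_upwards [h1, h2] with t h1 h2
        calc ‖(x + y) t - (x' + y') t‖ = ‖(x t - x' t) + (y t - y' t)‖ := by
              congr 1; simp only [Pi.add_apply]; abel
          _ ≤ ε := (norm_add_le _ _).trans (by linarith)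
      mul_mem' := by
        intro x y hx hy t₀ ε hε
        obtain ⟨x₁, hx₁, h1⟩ := hx t₀ 1 one_pos
        have hX := 𝒰.continuous_norm x₁ hx₁
        set C : ℝ := ‖x₁ t₀‖ + 2 with hC
        have hCpos : 0 < C := by positivity
        obtain ⟨y', hy', h2⟩ := hy t₀ (ε / (2 * C)) (by positivity)
        have hY := 𝒰.continuous_norm y' hy'
        set D : ℝ := ‖y' t₀‖ + 1 with hD
        have hDpos : 0 < D := by positivity
        obtain ⟨x', hx', h3⟩ := hx t₀ (ε / (2 * D)) (by positivity)
        refine ⟨x' * y', mul_mem hx' hy', ?_⟩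
        have e1 : ∀ᶠ t : Y in 𝓝 t₀, ‖x₁ t‖ < ‖x₁ t₀‖ + 1 :=
          (hX.comp continuous_subtype_val).continuousAt.eventually_lt continuousAt_const
            (by simp)
        have e2 : ∀ᶠ t : Y in 𝓝 t₀, ‖y' t‖ < D :=
          (hY.comp continuous_subtype_val).continuousAt.eventually_lt continuousAt_const
            (by simp [hD])
        filter_upwards [h1, h2, h3, e1, e2] with t h1 h2 h3 e1 e2
        have hxC : ‖x t‖ ≤ C := by
          have := norm_add_le (x t - x₁ t) (x₁ t)
          rw [sub_add_cancel] at this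
          linarith
        calc ‖(x * y) t - (x' * y') t‖ = ‖x t * (y t - y' t) + (x t - x' t) * y' t‖ := by
              congr 1; simp only [Pi.mul_apply, mul_sub, sub_mul]; abel
          _ ≤ ‖x t‖ * ‖y t - y' t‖ + ‖x t - x' t‖ * ‖y' t‖ :=
              (norm_add_le _ _).trans (add_le_add (norm_mul_le _ _) (norm_mul_le _ _))
          _ ≤ C * (ε / (2 * C)) + (ε / (2 * D)) * D := by gcongr
          _ = ε := by field_simp; ring
      smul_mem' := by
        intro c x hx t₀ ε hε
        obtain ⟨x', hx', h⟩ := hx t₀ (ε / (‖c‖ + 1)) (by positivity)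
        refine ⟨c • x', SMulMemClass.smul_mem c hx', ?_⟩
        filter_upwards [h] with t h
        calc ‖(c • x) t - (c • x') t‖ = ‖c • (x t - x' t)‖ := by
              simp only [Pi.smul_apply, smul_sub]
          _ ≤ (‖c‖ + 1) * (ε / (‖c‖ + 1)) := by
              rw [norm_smul]; gcongr; linarith
          _ = ε := by field_simp }
  dense t := by
    refine (𝒰.dense t).mono ?_
    rintro a ⟨x, hx, rfl⟩
    exact ⟨fun s => x s, fun t₀ ε hε => ⟨x, hx, by simpa using hε.le⟩, rfl⟩
  continuous_norm x hx := by
    refine continuous_of_locally_uniform_approx_of_continuousAt fun t₀ V hV => ?_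
    obtain ⟨ε, hε, hV⟩ := Metric.mem_uniformity_dist.1 hV
    obtain ⟨x', hx', h⟩ := hx t₀ (ε / 2) (half_pos hε)
    refine ⟨_, h, fun t => ‖x' t‖,
      ((𝒰.continuous_norm x' hx').comp continuous_subtype_val).continuousAt, fun t ht => hV ?_⟩
    rw [Real.dist_eq]
    exact lt_of_le_of_lt ((abs_norm_sub_norm_le _ _).trans ht) (half_lt_self hε)
  locally_closed x hx := by
    intro t₀ ε hε
    obtain ⟨y, hy, h1⟩ := hx t₀ (ε / 2) (half_pos hε)
    obtain ⟨x', hx', h2⟩ := hy t₀ (ε / 2) (half_pos hε)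
    refine ⟨x', hx', ?_⟩
    filter_upwards [h1, h2] with t h1 h2
    have := norm_sub_le_norm_sub_add_norm_sub (x t) (y t) (x' t)
    linarith

/-- An isomorphism of continuous fields of Banach algebras over `Ω`: a family of isometric algebra
isomorphisms of the fibres that transforms `Θ` into `Θ'`. -/
structure Iso {A' : Ω → Type v} [∀ t, NonUnitalNormedRing (A' t)] [∀ t, NormedSpace ℂ (A' t)]
    (𝒰 : ContinuousField A) (𝒰' : ContinuousField A') where
  toFun : ∀ t, A t ≃ₗᵢ[ℂ] A' t
  map_mul : ∀ t (a b : A t), toFun t (a * b) = toFun t a * toFun t b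
  map_Θ : ∀ x : ∀ t, A t, x ∈ 𝒰.Θ ↔ (fun t => toFun t (x t)) ∈ 𝒰'.Θ

/-- A field is trivial if it is isomorphic to the constant field defined by a Banach algebra. -/
def IsTrivial (𝒰 : ContinuousField A) : Prop :=
  ∃ (B : Type v) (_ : NonUnitalNormedRing B) (_ : NormedSpace ℂ B) (_ : IsScalarTower ℂ B B)
    (_ : SMulCommClass ℂ B B) (_ : CompleteSpace B), Nonempty (𝒰.Iso (const Ω B))

/-- `𝒰` is σ-locally trivial: there are an open cover `𝓒` of `Ω` such that `𝒰` is trivial on each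
member of `𝓒`, and a countable open cover `𝓥` of `Ω` such that the closure of each member
of `𝓥` lies in a member of `𝓒`. -/
def IsSigmaLocallyTrivial (𝒰 : ContinuousField A) : Prop :=
  ∃ 𝓒 : Set (Set Ω), (∀ U ∈ 𝓒, IsOpen U ∧ (𝒰.restrict U).IsTrivial) ∧ ⋃₀ 𝓒 = Set.univ ∧
    ∃ 𝓥 : Set (Set Ω), 𝓥.Countable ∧ (∀ V ∈ 𝓥, IsOpen V ∧ ∃ U ∈ 𝓒, closure V ⊆ U) ∧
      ⋃₀ 𝓥 = Set.univ

/-- The Banach algebra defined by `𝒰`: the members `x` of `Θ` for which `‖x t‖` vanishes at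
infinity, with the supremum norm (inherited from the bounded vector fields `lp A ∞`). -/
def sectionAlgebra (𝒰 : ContinuousField A) : NonUnitalSubalgebra ℂ (lp A ∞) where
  carrier := {x | (x : ∀ t, A t) ∈ 𝒰.Θ ∧ Tendsto (fun t => ‖x t‖) (cocompact Ω) (𝓝 0)}
  zero_mem' := ⟨zero_mem _, by simpa using tendsto_const_nhds⟩
  add_mem' := by
    rintro x y ⟨hx, hx'⟩ ⟨hy, hy'⟩
    refine ⟨add_mem hx hy, ?_⟩
    exact squeeze_zero (fun _ => norm_nonneg _) (fun t => norm_add_le (x t) (y t))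
      (by simpa using hx'.add hy')
  mul_mem' := by
    rintro x y ⟨hx, hx'⟩ ⟨hy, hy'⟩
    refine ⟨mul_mem hx hy, ?_⟩
    exact squeeze_zero (fun _ => norm_nonneg _) (fun t => norm_mul_le (x t) (y t))
      (by simpa using hx'.mul hy')
  smul_mem' := by
    rintro c x ⟨hx, hx'⟩
    refine ⟨SMulMemClass.smul_mem c hx, ?_⟩
    exact squeeze_zero (fun _ => norm_nonneg _) (fun t => (norm_smul c (x t)).le)
      (by simpa using hx'.const_mul ‖c‖)

/-- Boundedness is automatic: a member of `Θ` whose norm vanishes at infinity is bounded, so it is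
an element of the section algebra. -/
theorem memℓp_of_vanishing (𝒰 : ContinuousField A) {x : ∀ t, A t} (hx : x ∈ 𝒰.Θ)
    (h : Tendsto (fun t => ‖x t‖) (cocompact Ω) (𝓝 0)) : Memℓp x ∞ := by
  refine memℓp_infty ?_
  obtain ⟨K, hK, hKx⟩ := mem_cocompact.1 (h.eventually (gt_mem_nhds one_pos))
  obtain ⟨C, hC⟩ := hK.bddAbove_image (𝒰.continuous_norm x hx).continuousOn
  refine ⟨max C 1, ?_⟩
  rintro _ ⟨t, rfl⟩
  by_cases ht : t ∈ K
  · exact le_max_of_le_left (hC ⟨t, ht, rfl⟩)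
  · exact le_max_of_le_right (le_of_lt (hKx ht))

noncomputable instance (𝒰 : ContinuousField A) : NormedSpace ℂ 𝒰.sectionAlgebra where
  norm_smul_le c x := norm_smul_le c (x : lp A ∞)

instance [∀ t, CompleteSpace (A t)] (𝒰 : ContinuousField A) : CompleteSpace 𝒰.sectionAlgebra := by
  have hcl : IsClosed (𝒰.sectionAlgebra : Set (lp A ∞)) := by
    refine isClosed_of_closure_subset fun x hx => ?_
    have key : ∀ ε > 0, ∃ y ∈ 𝒰.sectionAlgebra, ∀ t, ‖x t - y t‖ ≤ ε := by
      intro ε hε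
      obtain ⟨y, hy, hxy⟩ := Metric.mem_closure_iff.1 hx ε hε
      refine ⟨y, hy, fun t => ?_⟩
      rw [dist_eq_norm] at hxy
      exact (lp.norm_apply_le_norm ENNReal.top_ne_zero (x - y) t).trans hxy.le
    constructor
    · refine 𝒰.locally_closed _ fun t₀ ε hε => ?_
      obtain ⟨y, hy, h⟩ := key ε hε
      exact ⟨y, hy.1, Eventually.of_forall h⟩
    · rw [Metric.tendsto_nhds]
      intro ε hε
      obtain ⟨y, hy, h⟩ := key (ε / 2) (half_pos hε)
      filter_upwards [(Metric.tendsto_nhds.1 hy.2) (ε / 2) (half_pos hε)] with t ht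
      simp only [dist_zero_right, norm_norm] at ht ⊢
      have := norm_add_le (x t - y t) (y t)
      rw [sub_add_cancel] at this
      linarith [h t]
  exact hcl.completeSpace_coe

end ContinuousField

end Fields

/-!
Over a closed set `Z` on which the field is trivial with fibre `B`, projectivity provides an
equivariant section `ρ` of the module of pairs `(a, F)`, where `F` is a kernel on `Z × Z` whose
diagonal is `a`. The kernel `ρ (a b) s t = a s * ρ b s t` depends on `a` only through its value
at `s`, so for `x * y ≠ 0` in `B` the kernels of the sections `f x * f y`, with cut-off functions
`f`, are local pieces of a single kernel `k` on `Z × Z` with diagonal `x * y`. Projectivity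
also rules out fibres with zero multiplication.

The relation `δ < ‖k s t‖` is a neighbourhood of the diagonal. As `k s` vanishes at infinity and
depends continuously on `s`, it relates the points of a compact set to those of a compact set
only. Countably many such relations generate an equivalence relation with open σ-compact classes.
-/

open scoped BoundedContinuousFunction SetRel

section Topology

variable {X : Type*} [TopologicalSpace X]

theorem paracompactSpace_of_iUnion_disjoint {ι : Type*} {W : ι → Set X}
    (hopen : ∀ i, IsOpen (W i)) (hdisj : Pairwise fun i j => Disjoint (W i) (W j))
    (hcover : ⋃ i, W i = Set.univ) (hpara : ∀ i, ParacompactSpace (W i)) :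
    ParacompactSpace X := by
  refine ⟨fun α c hc hcov => ?_⟩
  have hrefine (i : ι) := precise_refinement (X := W i) (fun a => Subtype.val ⁻¹' c a)
    (fun a => (hc a).preimage continuous_subtype_val) (by rw [← Set.preimage_iUnion, hcov]; rfl)
  choose t ht_open ht_cover ht_fin ht_sub using hrefine
  refine ⟨α, fun a => ⋃ i, Subtype.val '' t i a, fun a => isOpen_iUnion fun i =>
    (hopen i).isOpenMap_subtype_val _ (ht_open i a), ?_, fun x => ?_, fun a => ⟨a, ?_⟩⟩
  · refine Set.eq_univ_of_forall fun x => ?_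
    obtain ⟨i, hi⟩ := Set.iUnion_eq_univ_iff.1 hcover x
    obtain ⟨a, ha⟩ := Set.iUnion_eq_univ_iff.1 (ht_cover i) ⟨x, hi⟩
    exact Set.mem_iUnion₂.2 ⟨a, i, _, ha, rfl⟩
  · obtain ⟨i, hi⟩ := Set.iUnion_eq_univ_iff.1 hcover x
    obtain ⟨N, hN, hfin⟩ := ht_fin i ⟨x, hi⟩
    refine ⟨Subtype.val '' N, (hopen i).isOpenMap_subtype_val.image_mem_nhds hN,
      hfin.subset ?_⟩
    rintro a ⟨_, hy, z, hz, rfl⟩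
    obtain ⟨j, w, hw, hwz⟩ := Set.mem_iUnion.1 hy
    obtain rfl : j = i := hdisj.eq (Set.not_disjoint_iff.2 ⟨w, w.2, hwz ▸ z.2⟩)
    obtain rfl := Subtype.ext hwz
    exact ⟨w, hw, hz⟩
  · rintro _ ⟨_, ⟨i, rfl⟩, z, hz, rfl⟩
    exact ht_sub i a hz

theorem isClopen_of_iUnion_disjoint {ι : Type*} {W : ι → Set X} (hopen : ∀ i, IsOpen (W i))
    (hdisj : Pairwise fun i j => Disjoint (W i) (W j)) (hcover : ⋃ i, W i = Set.univ) (i : ι) :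
    IsClopen (W i) := by
  refine ⟨?_, hopen i⟩
  rw [← isOpen_compl_iff]
  have hcompl : (W i)ᶜ = ⋃ j ≠ i, W j := by
    ext x
    obtain ⟨k, hk⟩ := Set.iUnion_eq_univ_iff.1 hcover x
    simp only [Set.mem_compl_iff, Set.mem_iUnion]
    refine ⟨fun hx => ⟨k, fun h => hx (h ▸ hk), hk⟩, ?_⟩
    rintro ⟨j, hji, hj⟩ hi
    exact Set.disjoint_left.1 (hdisj hji) hj hi
  exact hcompl ▸ isOpen_biUnion fun j _ => hopen j

theorem exists_isSigmaCompact_reachable {R : SetRel X X}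
    (hR : ∀ K, IsCompact K → ∃ S, IsSigmaCompact S ∧ R.image K ⊆ S) (x : X) :
    ∃ S, IsSigmaCompact S ∧ {y | Relation.ReflTransGen (· ~[R] ·) x y} ⊆ S := by
  have hσ (T : Set X) (hT : IsSigmaCompact T) : ∃ S, IsSigmaCompact S ∧ R.image T ⊆ S := by
    obtain ⟨K, hK, rfl⟩ := hT
    choose S hS hsub using fun n => hR (K n) (hK n)
    refine ⟨⋃ n, S n, isSigmaCompact_iUnion S hS, ?_⟩
    rw [SetRel.image_iUnion]
    exact Set.iUnion_mono hsub
  choose! next hnext hstep using hσ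
  have hiter (n : ℕ) : IsSigmaCompact (next^[n] {x}) :=
    Function.Iterate.rec _ isCompact_singleton.isSigmaCompact (fun _ => hnext _) n
  refine ⟨⋃ n, next^[n] {x}, isSigmaCompact_iUnion _ hiter, fun y hy => ?_⟩
  induction hy with
  | refl => exact Set.mem_iUnion.2 ⟨0, rfl⟩
  | tail _ hyz ih =>
    obtain ⟨n, hn⟩ := Set.mem_iUnion.1 ih
    refine Set.mem_iUnion.2 ⟨n + 1, ?_⟩
    rw [Function.iterate_succ_apply']
    exact hstep _ (hiter n) ⟨_, hn, hyz⟩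

theorem paracompactSpace_of_setRel [T2Space X] [LocallyCompactSpace X] {R : SetRel X X}
    (hdiag : ∀ x, R ∈ 𝓝 (x, x))
    (hR : ∀ K, IsCompact K → ∃ S, IsSigmaCompact S ∧ R.image K ⊆ S) : ParacompactSpace X := by
  let Q : SetRel X X := R ∩ R.inv
  have hsymm : Std.Symm fun x y => x ~[Q] y := ⟨fun _ _ h => h.symm⟩
  have hQ (x : X) : ∀ᶠ y in 𝓝 x, x ~[Q] y :=
    ((Continuous.prodMk_right x).continuousAt.eventually (hdiag x)).and
      ((Continuous.prodMk_left x).continuousAt.eventually (hdiag x))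
  let D : DiscreteQuotient X :=
    { r := Relation.ReflTransGen (· ~[Q] ·)
      iseqv := ⟨fun _ => .refl, fun h => Std.Symm.symm _ _ h, .trans⟩
      isOpen_setOfPred_rel := fun x => isOpen_iff_mem_nhds.2 fun y hy =>
        (hQ y).mono fun z hz => Relation.ReflTransGen.tail hy hz }
  refine paracompactSpace_of_iUnion_disjoint (W := fun q : D => D.proj ⁻¹' {q})
    (fun q => D.isOpen_preimage {q})
    (fun q q' h => (Set.disjoint_singleton.2 h).preimage D.proj)
    (by rw [← Set.preimage_iUnion, Set.iUnion_of_singleton, Set.preimage_univ])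
    (D.proj_surjective.forall.2 fun x => ?_)
  obtain ⟨S, hS, hxS⟩ := exists_isSigmaCompact_reachable hR x
  have hσ : IsSigmaCompact (D.proj ⁻¹' {D.proj x}) := by
    refine hS.of_isClosed_subset (D.isClosed_preimage _) (subset_trans ?_ hxS)
    rw [D.fiber_eq]
    exact fun y hy => Relation.ReflTransGen.mono (fun _ _ h => h.1) _ _ hy
  have := isSigmaCompact_iff_sigmaCompactSpace.1 hσ
  have := (D.isOpen_preimage {D.proj x}).locallyCompactSpace
  infer_instance

/-- The relation `R` on `X` sends compact sets to relatively compact sets (in the form of being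
contained in a compact set, which is the same in Hausdorff spaces). -/
def IsCompactlyBounded (R : SetRel X X) : Prop :=
  ∀ K, IsCompact K → ∃ S, IsCompact S ∧ R.image K ⊆ S

theorem paracompactSpace_of_countable_setRel [T2Space X] [LocallyCompactSpace X] {ι : Type*}
    [Countable ι] {R : ι → SetRel X X} (hR : ∀ i, IsCompactlyBounded (R i))
    (hdiag : ∀ x, ∃ i, R i ∈ 𝓝 (x, x)) : ParacompactSpace X := by
  refine paracompactSpace_of_setRel (R := ⋃ i, R i)
    (fun x => (hdiag x).elim fun i hi => mem_of_superset hi (Set.subset_iUnion R i))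
    fun K hK => ?_
  choose S hS hsub using fun i => hR i K hK
  refine ⟨⋃ i, S i, isSigmaCompact_iUnion S fun i => (hS i).isSigmaCompact, ?_⟩
  rintro y ⟨x, hx, hxy⟩
  obtain ⟨i, hi⟩ := Set.mem_iUnion.1 hxy
  exact Set.mem_iUnion.2 ⟨i, hsub i ⟨x, hx, hi⟩⟩

namespace IsCompactlyBounded

variable {Y : Type*} [TopologicalSpace Y] {f : X → Y}

theorem image {R : SetRel X X} (hR : IsCompactlyBounded R) (hf : IsClosedEmbedding f) :
    IsCompactlyBounded (Prod.map f f '' R) := by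
  intro K hK
  obtain ⟨S, hS, hsub⟩ := hR _ (hf.isCompact_preimage hK)
  refine ⟨f '' S, hS.image hf.continuous, ?_⟩
  rintro _ ⟨_, hx, ⟨x, y⟩, hxy, ⟨⟩⟩
  exact ⟨y, hsub ⟨x, hx, hxy⟩, rfl⟩

theorem preimage {R : SetRel Y Y} (hR : IsCompactlyBounded R) (hf : IsClosedEmbedding f) :
    IsCompactlyBounded (Prod.map f f ⁻¹' R) := by
  intro K hK
  obtain ⟨S, hS, hsub⟩ := hR _ (hK.image hf.continuous)
  refine ⟨f ⁻¹' S, hf.isCompact_preimage hS, ?_⟩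
  rintro y ⟨x, hx, hxy⟩
  exact hsub ⟨f x, ⟨x, hx, rfl⟩, hxy⟩

end IsCompactlyBounded

theorem eventually_forall_norm_lt_of_isCompact {Y E : Type*} [TopologicalSpace Y]
    [NormedAddCommGroup E] {F : X → Y →ᵇ E} (hF : Continuous F) {l : Filter Y}
    (hlim : ∀ x, Tendsto (F x) l (𝓝 0)) {K : Set X} (hK : IsCompact K) {δ : ℝ} (hδ : 0 < δ) :
    ∀ᶠ y in l, ∀ x ∈ K, ‖F x y‖ < δ := by
  suffices h : ∀ x ∈ K, ∀ᶠ p in l ×ˢ 𝓝 x, ‖F p.2 p.1‖ < δ by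
    obtain ⟨u, hu, v, hv, huv⟩ := mem_prod_iff.1 (hK.mem_prod_nhdsSet_of_forall h)
    filter_upwards [hu] with y hy x hx using
      huv (Set.mk_mem_prod hy (subset_of_mem_nhdsSet hv hx))
  intro x _
  have hbound (p : Y × X) : ‖F p.2 p.1‖ ≤ ‖F x p.1‖ + dist (F p.2) (F x) := by
    have := (F p.2).dist_coe_le_dist (g := F x) p.1
    rw [dist_eq_norm] at this
    linarith [norm_le_norm_add_norm_sub' (F p.2 p.1) (F x p.1)]
  have hzero : Tendsto (fun p : Y × X => ‖F x p.1‖ + dist (F p.2) (F x)) (l ×ˢ 𝓝 x) (𝓝 0) := by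
    simpa using ((hlim x).norm.comp tendsto_fst).add
      ((tendsto_iff_dist_tendsto_zero.1 (hF.tendsto x)).comp tendsto_snd)
  exact (hzero.eventually_lt_const hδ).mono fun p hp => (hbound p).trans_lt hp

theorem exists_isCompactlyBounded_of_kernels [LocallyCompactSpace X] {E F : Type*}
    [NormedAddCommGroup E] {c : F → Set X} (hc : ∀ K, IsCompact K → ∃ f, K ⊆ c f)
    {k : F → X → X →ᵇ E} (hk : ∀ f, Continuous (k f))
    (hk_zero : ∀ f s, Tendsto (k f s) (cocompact X) (𝓝 0))
    (hk_agree : ∀ f g, ∀ s ∈ c f ∩ c g, k f s = k g s)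
    {δ : ℝ} (hδ : 0 < δ) (hk_diag : ∀ f, ∀ s ∈ c f, δ < ‖k f s s‖) :
    ∃ R : SetRel X X, IsCompactlyBounded R ∧ ∀ x, R ∈ 𝓝 (x, x) := by
  refine ⟨{p | ∃ f, p.1 ∈ c f ∧ δ < ‖k f p.1 p.2‖}, fun K hK => ?_, fun x => ?_⟩
  · obtain ⟨f, hf⟩ := hc K hK
    obtain ⟨S, hS, hsub⟩ := mem_cocompact.1
      (eventually_forall_norm_lt_of_isCompact (hk f) (hk_zero f) hK hδ)
    refine ⟨S, hS, ?_⟩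
    rintro t ⟨s, hs, g, hg, hgt⟩
    rw [hk_agree g f s ⟨hg, hf hs⟩] at hgt
    by_contra ht
    exact hgt.not_gt (hsub ht s hs)
  · obtain ⟨K, hK, hx⟩ := exists_compact_mem_nhds x
    obtain ⟨f, hf⟩ := hc K hK
    have hcont : Continuous fun p : X × X => ‖k f p.1 p.2‖ :=
      (((hk f).comp continuous_fst).eval continuous_snd).norm
    filter_upwards [continuous_fst.continuousAt.preimage_mem_nhds hx,
      hcont.continuousAt.eventually_const_lt (hk_diag f x (hf (mem_of_mem_nhds hx)))] with p hp hlt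
    exact ⟨f, hf hp, hlt⟩

end Topology

section BoundedFunctions

variable {𝕜 X E F G : Type*} [NontriviallyNormedField 𝕜] [TopologicalSpace X]
  [NormedAddCommGroup E] [NormedSpace 𝕜 E] [NormedAddCommGroup F] [NormedSpace 𝕜 F]
  [NormedAddCommGroup G] [NormedSpace 𝕜 G]

/-- The pointwise application of a bounded bilinear map to two bounded continuous functions. -/
noncomputable def pointwise (L : E →L[𝕜] F →L[𝕜] G) :
    (X →ᵇ E) →L[𝕜] (X →ᵇ F) →L[𝕜] (X →ᵇ G) :=
  have hbound (f : X →ᵇ E) (g : X →ᵇ F) (x : X) : ‖L (f x) (g x)‖ ≤ ‖L‖ * ‖f‖ * ‖g‖ :=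
    L.le_of_opNorm₂_le_of_le le_rfl (f.norm_coe_le_norm x) (g.norm_coe_le_norm x)
  LinearMap.mkContinuous₂
    (LinearMap.mk₂ 𝕜
      (fun f g => .ofNormedAddCommGroup (fun x => L (f x) (g x)) (by fun_prop) _ (hbound f g))
      (fun f f' g => by ext x; simp) (fun c f g => by ext x; simp)
      (fun f g g' => by ext x; simp) (fun c f g => by ext x; simp))
    ‖L‖ fun f g => BoundedContinuousFunction.norm_ofNormedAddCommGroup_le _ (by positivity)
      (hbound f g)

variable (𝕜 X E) in
/-- `BoundedContinuousFunction.const` as a bounded linear map. -/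
noncomputable def constL : E →L[𝕜] (X →ᵇ E) :=
  LinearMap.mkContinuous
    { toFun := BoundedContinuousFunction.const X, map_add' _ _ := rfl, map_smul' _ _ := rfl } 1
    fun b => (BoundedContinuousFunction.norm_const_le b).trans_eq (one_mul _).symm

theorem isClosed_setOf_tendsto_cocompact_zero :
    IsClosed {f : X →ᵇ E | Tendsto f (cocompact X) (𝓝 0)} := by
  convert ZeroAtInftyContinuousMap.isClosed_range_toBCF (α := X) (β := E)
  ext f
  refine ⟨fun hf => ⟨⟨f.toContinuousMap, hf⟩, rfl⟩, ?_⟩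
  rintro ⟨g, rfl⟩
  exact g.zero_at_infty'

end BoundedFunctions

section Projectivity

/-- The associative bounded bilinear multiplication `m` makes `E` into a left projective Banach
algebra. Taking for `m` the multiplication of a Banach algebra, or the opposite multiplication,
covers left and right projectivity. -/
structure IsProjectiveMul {E : Type w} [NormedAddCommGroup E] [NormedSpace ℂ E]
    (m : E →L[ℂ] E →L[ℂ] E) : Prop where
  assoc : ∀ a b c, m (m a b) c = m a (m b c)
  exists_section : ∀ (Y : Type w) [NormedAddCommGroup Y] [NormedSpace ℂ Y] [CompleteSpace Y]
    (act : E →L[ℂ] Y →L[ℂ] Y) (φ : Y →L[ℂ] E),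
    (∀ a b y, act (m a b) y = act a (act b y)) → (∀ a y, φ (act a y) = m a (φ y)) →
    (∃ σ : E →L[ℂ] Y, ∀ x, φ (σ x) = x) →
    ∃ ψ : E →L[ℂ] Y, (∀ a x, ψ (m a x) = act a (ψ x)) ∧ ∀ x, φ (ψ x) = x

section

variable {A : Type w} [NonUnitalNormedRing A] [NormedSpace ℂ A] [IsScalarTower ℂ A A]
  [SMulCommClass ℂ A A] [CompleteSpace A]

theorem IsLeftProjective.isProjectiveMul (h : IsLeftProjective A) :
    IsProjectiveMul (ContinuousLinearMap.mul ℂ A) :=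
  ⟨mul_assoc, fun Y _ _ _ act φ hact hφ hσ => h Y ⟨act, hact⟩ φ hφ hσ⟩

theorem IsRightProjective.isProjectiveMul (h : IsRightProjective A) :
    IsProjectiveMul (ContinuousLinearMap.mul ℂ A).flip :=
  ⟨fun a b c => (mul_assoc c b a).symm,
    fun Y _ _ _ act φ hact hφ hσ => h Y ⟨act, fun a b => hact b a⟩ φ hφ hσ⟩

end

/-- The restriction of a bounded bilinear action on `Y` to an invariant subspace. -/
noncomputable def restrictAction {𝕜 E Y : Type*} [NontriviallyNormedField 𝕜]
    [NormedAddCommGroup E] [NormedSpace 𝕜 E] [NormedAddCommGroup Y] [NormedSpace 𝕜 Y]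
    (act : E →L[𝕜] Y →L[𝕜] Y) (N : Submodule 𝕜 Y) (hN : ∀ a, ∀ y ∈ N, act a y ∈ N) :
    E →L[𝕜] N →L[𝕜] N :=
  LinearMap.mkContinuous₂
    (LinearMap.mk₂ 𝕜 (fun a y => ⟨act a y, hN a y y.2⟩) (fun _ _ _ => by ext; simp)
      (fun _ _ _ => by ext; simp) (fun _ _ _ => by ext; simp) (fun _ _ _ => by ext; simp))
    ‖act‖ fun a y => act.le_opNorm₂ a y

section

variable {Z : Type u} [TopologicalSpace Z] {B : Type v} [NormedAddCommGroup B] [NormedSpace ℂ B]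
  {E : Type w} [NormedAddCommGroup E] [NormedSpace ℂ E] {r : E →L[ℂ] (Z →ᵇ B)}

/-- The pairs `(a, F)` of an element `a` and a kernel `F` on `Z × Z` that vanishes at infinity in
the second variable and restricts to the function `r a` on the diagonal. -/
def diagonalKernels (r : E →L[ℂ] (Z →ᵇ B)) : Submodule ℂ (E × (Z →ᵇ Z →ᵇ B)) where
  carrier := {p | (∀ s, Tendsto (p.2 s) (cocompact Z) (𝓝 0)) ∧ ∀ t, p.2 t t = r p.1 t}
  zero_mem' := ⟨fun _ => tendsto_const_nhds, fun t => by simp⟩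
  add_mem' hp hq := ⟨fun s => by simpa [Pi.add_def] using (hp.1 s).add (hq.1 s), fun t => by
    simp [hp.2 t, hq.2 t]⟩
  smul_mem' c _ hp := ⟨fun s => by simpa using (hp.1 s).const_smul c, fun t => by simp [hp.2 t]⟩

theorem isClosed_diagonalKernels :
    IsClosed (diagonalKernels r : Set (E × (Z →ᵇ Z →ᵇ B))) := by
  have heval (s : Z) : Continuous fun p : E × (Z →ᵇ Z →ᵇ B) => p.2 s :=
    (continuous_eval_const s).comp continuous_snd
  refine IsClosed.and ?_ ?_ <;> simp only [Set.ofPred_forall]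
  · exact isClosed_iInter fun s => isClosed_setOf_tendsto_cocompact_zero.preimage (heval s)
  · exact isClosed_iInter fun t => isClosed_eq
      ((continuous_eval_const t).comp (heval t))
      ((continuous_eval_const t).comp (r.continuous.comp continuous_fst))

end

namespace IsProjectiveMul

section

variable {E : Type w} [NormedAddCommGroup E] [NormedSpace ℂ E] [CompleteSpace E]
  {m : E →L[ℂ] E →L[ℂ] E}

theorem exists_equivariant_section (hm : IsProjectiveMul m) {K : Type w} [NormedAddCommGroup K]
    [NormedSpace ℂ K] [CompleteSpace K] {κ : E →L[ℂ] K →L[ℂ] K}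
    (hκ : ∀ a b x, κ (m a b) x = κ a (κ b x)) {N : Submodule ℂ (E × K)}
    (hN : IsClosed (N : Set (E × K))) (hN_act : ∀ a, ∀ p ∈ N, (m a p.1, κ a p.2) ∈ N)
    (s : E →L[ℂ] K) (hs : ∀ a, (a, s a) ∈ N) :
    ∃ ρ : E →L[ℂ] K, (∀ a, (a, ρ a) ∈ N) ∧ ∀ a b, ρ (m a b) = κ a (ρ b) := by
  have : CompleteSpace N := hN.completeSpace_coe
  let act : E →L[ℂ] (E × K) →L[ℂ] (E × K) :=
    ContinuousLinearMap.prodMapL ℂ E E K K ∘L m.prod κ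
  obtain ⟨ψ, hψ, hφ⟩ := hm.exists_section N (restrictAction act N hN_act)
    (.fst ℂ E K ∘L N.subtypeL)
    (fun a b y => Subtype.ext (Prod.ext (hm.assoc a b _) (hκ a b _))) (fun a y => rfl)
    ⟨((ContinuousLinearMap.id ℂ E).prod s).codRestrict N hs, fun x => rfl⟩
  refine ⟨.snd ℂ E K ∘L N.subtypeL ∘L ψ, fun a => ?_, fun a b => ?_⟩
  · have hfst : (ψ a).1.1 = a := hφ a
    exact (congrArg (·, (ψ a).1.2) hfst) ▸ (ψ a).2
  · exact congrArg (fun p : N => p.1.2) (hψ a b)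

/-- The pairs `(x, c) ∈ E × ℂ` form a module under `a · (x, c) = (a x, χ(a) χ(x))`, because `χ`
vanishes on products; an equivariant section of it maps `a ^ 2 = 0` to `(0, χ(a) ^ 2)`. -/
theorem apply_eq_zero_of_sq_eq_zero (hm : IsProjectiveMul m) {χ : E →L[ℂ] ℂ}
    (hχ : ∀ a b, χ (m a b) = 0) {a : E} (ha : m a a = 0) : χ a = 0 := by
  let act : E →L[ℂ] (E × ℂ) →L[ℂ] (E × ℂ) :=
    (ContinuousLinearMap.fst ℂ E ℂ).precomp (E × ℂ) ∘L
      ((ContinuousLinearMap.inl ℂ E ℂ).postcomp E ∘L m +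
        (ContinuousLinearMap.inr ℂ E ℂ).postcomp E ∘L χ.smulRight χ)
  have hact (b : E) (p : E × ℂ) : act b p = (m b p.1, χ b * χ p.1) := by simp [act]
  obtain ⟨ψ, hψ, hφ⟩ := hm.exists_section (E × ℂ) act (.fst ℂ E ℂ)
    (fun a b p => by simp [hact, hm.assoc, hχ]) (fun a p => by simp [hact])
    ⟨.inl ℂ E ℂ, fun x => rfl⟩
  have hsq : ψ (m a a) = (m a a, χ a * χ a) := by
    rw [hψ, hact, show (ψ a).1 = a from hφ a]
  rw [ha, map_zero] at hsq
  exact mul_self_eq_zero.1 (congrArg Prod.snd hsq).symm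

theorem exists_apply_ne_zero (hm : IsProjectiveMul m) {B : Type*} [NormedAddCommGroup B]
    [NormedSpace ℂ B] [Nontrivial B] {mB : B →L[ℂ] B →L[ℂ] B} {e : E →L[ℂ] B}
    (he : ∀ a b, e (m a b) = mB (e a) (e b))
    (hlift : ∀ x, mB x x = 0 → ∃ a, e a = x ∧ m a a = 0) : ∃ x y, mB x y ≠ 0 := by
  by_contra! hmB
  obtain ⟨b, hb⟩ := exists_ne (0 : B)
  obtain ⟨χ, hχ⟩ := SeparatingDual.exists_ne_zero (R := ℂ) hb
  obtain ⟨a, rfl, ha⟩ := hlift b (hmB b b)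
  exact hχ (hm.apply_eq_zero_of_sq_eq_zero (χ := χ ∘L e) (fun a b => by simp [he, hmB]) ha)

end

section

variable {Z : Type u} [TopologicalSpace Z] {B : Type v} [NormedAddCommGroup B] [NormedSpace ℂ B]
  {E : Type (max u v)} [NormedAddCommGroup E] [NormedSpace ℂ E] {m : E →L[ℂ] E →L[ℂ] E}
  {mB : B →L[ℂ] B →L[ℂ] B} {r : E →L[ℂ] (Z →ᵇ B)} [CompleteSpace E] [CompleteSpace B]

theorem exists_kernel (hm : IsProjectiveMul m)
    (hassoc : ∀ x y z, mB (mB x y) z = mB x (mB y z))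
    (hr_mul : ∀ a b t, r (m a b) t = mB (r a t) (r b t))
    (hr_zero : ∀ a, Tendsto (r a) (cocompact Z) (𝓝 0)) :
    ∃ ρ : E →L[ℂ] (Z →ᵇ Z →ᵇ B), (∀ a t, ρ a t t = r a t) ∧
      (∀ a s, Tendsto (ρ a s) (cocompact Z) (𝓝 0)) ∧
      ∀ a b s t, ρ (m a b) s t = mB (r a s) (ρ b s t) := by
  let κ : E →L[ℂ] (Z →ᵇ Z →ᵇ B) →L[ℂ] (Z →ᵇ Z →ᵇ B) :=
    pointwise (pointwise mB ∘L constL ℂ Z B) ∘L r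
  have hκ_apply (a F s t) : κ a F s t = mB (r a s) (F s t) := rfl
  have hκ (a b F) : κ (m a b) F = κ a (κ b F) := by
    ext s t
    simp only [hκ_apply, hr_mul, hassoc]
  have hinv (a) (p) (hp : p ∈ diagonalKernels r) : (m a p.1, κ a p.2) ∈ diagonalKernels r := by
    refine ⟨fun s => ?_, fun t => ?_⟩
    · exact ((mB (r a s)).continuous.tendsto' 0 0 (map_zero _)).comp (hp.1 s)
    · rw [hκ_apply, hp.2, hr_mul]
  obtain ⟨ρ, hρ, hρ_mul⟩ := hm.exists_equivariant_section hκ isClosed_diagonalKernels hinv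
    (constL ℂ Z (Z →ᵇ B) ∘L r) (fun a => ⟨fun _ => hr_zero a, fun _ => rfl⟩)
  refine ⟨ρ, fun a => (hρ a).2, fun a => (hρ a).1, fun a b s t => ?_⟩
  rw [hρ_mul, hκ_apply]

/-- Since `E` need not contain the constant functions `x` on `Z`, their multiples `j f x` by the
cut-off functions `c f` take their place. -/
theorem exists_isCompactlyBounded_mem_nhds [LocallyCompactSpace Z] [Nonempty Z] [Nontrivial B]
    (hm : IsProjectiveMul m) (hassoc : ∀ x y z, mB (mB x y) z = mB x (mB y z))
    (hr_mul : ∀ a b t, r (m a b) t = mB (r a t) (r b t))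
    (hr_zero : ∀ a, Tendsto (r a) (cocompact Z) (𝓝 0))
    {F : Type*} [CommMagma F] {c : F → Z → ℂ}
    (hc : ∀ K, IsCompact K → ∃ f, ∀ t ∈ K, c f t = 1) {j : F → B → E}
    (hj : ∀ f x t, r (j f x) t = c f t • x)
    (hj_mul : ∀ f g x y, m (j f x) (j g y) = j (f * g) (mB x y))
    (hj_zero : ∀ f, j f 0 = 0) :
    ∃ R : SetRel Z Z, IsCompactlyBounded R ∧ ∀ z, R ∈ 𝓝 (z, z) := by
  obtain ⟨ρ, hρ_diag, hρ_zero, hρ_mul⟩ := hm.exists_kernel hassoc hr_mul hr_zero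
  have hρ_congr {a a' b : E} {s : Z} (h : r a s = r a' s) : ρ (m a b) s = ρ (m a' b) s := by
    ext t
    rw [hρ_mul, hρ_mul, h]
  obtain ⟨x, y, hxy⟩ : ∃ x y, mB x y ≠ 0 := by
    obtain ⟨z⟩ := ‹Nonempty Z›
    obtain ⟨f, hf⟩ := hc {z} isCompact_singleton
    refine hm.exists_apply_ne_zero (e := BoundedContinuousFunction.evalCLM ℂ z ∘L r)
      (fun a b => hr_mul a b z) fun x hx => ⟨j f x, ?_, by rw [hj_mul, hx, hj_zero]⟩
    exact (hj f x z).trans (by rw [hf z rfl, one_smul])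
  refine exists_isCompactlyBounded_of_kernels (c := fun f => {t | c f t = 1}) hc
    (k := fun f => ρ (m (j f x) (j f y))) (fun f => (ρ _).continuous) (fun f => hρ_zero _)
    ?_ (half_pos (norm_pos_iff.2 hxy)) ?_
  · rintro f g s ⟨hf, hg⟩
    have hr_eq (b : B) : r (j f b) s = r (j g b) s := by
      rw [hj, hj, Set.mem_ofPred.1 hf, Set.mem_ofPred.1 hg]
    calc ρ (m (j f x) (j f y)) s = ρ (m (j g x) (j f y)) s := hρ_congr (hr_eq x)
      _ = ρ (m (j f x) (j g y)) s := by rw [hj_mul, hj_mul, mul_comm]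
      _ = ρ (m (j g x) (j g y)) s := hρ_congr (hr_eq x)
  · intro f s hs
    rw [hρ_diag, hr_mul, hj, hj, Set.mem_ofPred.1 hs, one_smul, one_smul]
    exact half_lt_self (norm_pos_iff.2 hxy)

end

end IsProjectiveMul

end Projectivity

section Fields

namespace ContinuousField

variable {Ω : Type u} [TopologicalSpace Ω] {A : Ω → Type v} [∀ t, NonUnitalNormedRing (A t)]
  [∀ t, NormedSpace ℂ (A t)] {𝒰 : ContinuousField A}

theorem restrict_mem {x : ∀ t, A t} (hx : x ∈ 𝒰.Θ) (Y : Set Ω) :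
    (fun t : Y => x t) ∈ (𝒰.restrict Y).Θ :=
  fun _ _ hε => ⟨x, hx, .of_forall fun t => by simpa using le_of_lt hε⟩

theorem mem_restrict_restrict_iff {Y : Set Ω} {U : Set Y}
    {x : ∀ t : (Subtype.val '' U : Set Ω), A t} :
    (fun t : U => x ⟨t.1.1, Set.mem_image_of_mem _ t.2⟩) ∈ ((𝒰.restrict Y).restrict U).Θ ↔
      x ∈ (𝒰.restrict (Subtype.val '' U)).Θ := by
  let h : U ≃ₜ (Subtype.val '' U : Set Ω) := IsEmbedding.subtypeVal.homeomorphImage U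
  refine ⟨fun hx => h.surjective.forall.2 fun t₀ ε hε => ?_, fun hx t₀ ε hε => ?_⟩
  · obtain ⟨y, hy, hxy⟩ := hx t₀ (ε / 2) (half_pos hε)
    obtain ⟨z, hz, hyz⟩ := hy t₀ (ε / 2) (half_pos hε)
    refine ⟨z, hz, ?_⟩
    rw [← h.map_nhds_eq, eventually_map]
    filter_upwards [hxy, continuous_subtype_val.continuousAt.eventually hyz] with t hxy hyz
    exact (norm_sub_le_norm_sub_add_norm_sub _ (y t) _).trans
      ((add_le_add hxy hyz).trans_eq (add_halves ε))
  · obtain ⟨y, hy, hxy⟩ := hx (h t₀) ε hε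
    exact ⟨_, restrict_mem hy Y, h.continuous.continuousAt.eventually hxy⟩

theorem IsTrivial.of_restrict_restrict {Y : Set Ω} {U : Set Y}
    (htriv : ((𝒰.restrict Y).restrict U).IsTrivial) :
    (𝒰.restrict (Subtype.val '' U)).IsTrivial := by
  obtain ⟨B, _, _, hscalar, hcomm, hcomplete, ⟨e⟩⟩ := htriv
  let h : U ≃ₜ (Subtype.val '' U : Set Ω) := IsEmbedding.subtypeVal.homeomorphImage U
  have hmem (t : (Subtype.val '' U : Set Ω)) : ∃ ht : t.1 ∈ Y, ⟨t.1, ht⟩ ∈ U := by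
    obtain ⟨s, hs, hst⟩ := t.2
    exact ⟨hst ▸ s.2, by simpa only [← hst] using hs⟩
  refine ⟨B, _, _, hscalar, hcomm, hcomplete,
    ⟨⟨fun t => e.toFun ⟨⟨t.1, (hmem t).1⟩, (hmem t).2⟩, fun t => e.map_mul ⟨⟨t.1, (hmem t).1⟩, _⟩,
      fun x => ?_⟩⟩⟩
  rw [← mem_restrict_restrict_iff, e.map_Θ]
  exact h.comp_continuous_iff' (f := fun t => e.toFun ⟨⟨t.1, (hmem t).1⟩, (hmem t).2⟩ (x t))

/-- The functions that are compactly supported in `U`, as a semigroup under multiplication. -/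
def compactlySupportedIn (U : Set Ω) : Subsemigroup C(Ω, ℂ) where
  carrier := {f | HasCompactSupport f ∧ tsupport f ⊆ U}
  mul_mem' hf _ := ⟨hf.1.mul_right, tsupport_mul_subset_left.trans hf.2⟩

theorem exists_compactlySupportedIn_eq_one [T2Space Ω] [LocallyCompactSpace Ω] {K U : Set Ω}
    (hK : IsCompact K) (hU : IsOpen U) (hKU : K ⊆ U) :
    ∃ f : compactlySupportedIn U, ∀ t ∈ K, f.1 t = 1 := by
  obtain ⟨f, hf_one, hf_compact, hf_supp, -⟩ :=
    exists_continuousMap_one_of_isCompact_subset_isOpen hK hU hKU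
  have hsupp : tsupport (fun t => (f t : ℂ)) ⊆ tsupport f :=
    tsupport_comp_subset Complex.ofReal_zero f
  refine ⟨⟨⟨fun t => (f t : ℂ), by fun_prop⟩,
    hf_compact.of_isClosed_subset (isClosed_tsupport _) hsupp, hsupp.trans hf_supp⟩,
    fun t ht => ?_⟩
  simpa using hf_one ht

namespace Iso

variable {U : Set Ω} {B : Type v} [NonUnitalNormedRing B] [NormedSpace ℂ B] [IsScalarTower ℂ B B]
  [SMulCommClass ℂ B B] (e : (𝒰.restrict U).Iso (const U B))

theorem continuous_toFun {x : ∀ t, A t} (hx : x ∈ 𝒰.Θ) :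
    Continuous fun t : U => e.toFun t (x t) :=
  (e.map_Θ _).1 (restrict_mem hx U)

open Classical in
/-- The vector field over `Ω` that corresponds to `f` over `U` and vanishes outside `U`. -/
noncomputable def zeroExtension (f : Ω → B) (t : Ω) : A t :=
  if ht : t ∈ U then (e.toFun ⟨t, ht⟩).symm (f t) else 0

@[simp]
theorem toFun_zeroExtension (f : Ω → B) (t : U) : e.toFun t (e.zeroExtension f t) = f t := by
  rw [zeroExtension, dif_pos t.2]
  exact (e.toFun t).apply_symm_apply _

theorem zeroExtension_of_notMem (f : Ω → B) {t : Ω} (ht : t ∉ U) : e.zeroExtension f t = 0 :=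
  dif_neg ht

theorem eq_zeroExtension_iff {x : ∀ t, A t} {f : Ω → B} :
    x = e.zeroExtension f ↔ (∀ t : U, e.toFun t (x t) = f t) ∧ ∀ t ∉ U, x t = 0 := by
  refine ⟨?_, fun ⟨hU, hU'⟩ => funext fun t => ?_⟩
  · rintro rfl
    exact ⟨e.toFun_zeroExtension f, fun t => e.zeroExtension_of_notMem f⟩
  · by_cases ht : t ∈ U
    · exact (e.toFun ⟨t, ht⟩).injective ((hU ⟨t, ht⟩).trans (e.toFun_zeroExtension f ⟨t, ht⟩).symm)
    · rw [hU' t ht, e.zeroExtension_of_notMem f ht]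

theorem zeroExtension_eq_zero {f : Ω → B} {t : Ω} (ht : f t = 0) : e.zeroExtension f t = 0 := by
  rw [zeroExtension, ht]
  split_ifs <;> simp

theorem zeroExtension_mem (hU : IsOpen U) {f : Ω → B} (hf : Continuous f)
    (hf_supp : tsupport f ⊆ U) : e.zeroExtension f ∈ 𝒰.Θ := by
  refine 𝒰.locally_closed _ fun t₀ ε hε => ?_
  by_cases ht₀ : t₀ ∈ U
  · have hmem : (fun t : U => e.zeroExtension f t) ∈ (𝒰.restrict U).Θ := by
      refine (e.map_Θ _).2 ?_
      simp only [toFun_zeroExtension]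
      exact hf.comp continuous_subtype_val
    obtain ⟨x, hx, happrox⟩ := hmem ⟨t₀, ht₀⟩ ε hε
    refine ⟨x, hx, ?_⟩
    rwa [← hU.isOpenEmbedding_subtypeVal.map_nhds_eq ⟨t₀, ht₀⟩, eventually_map]
  · refine ⟨0, zero_mem _, ?_⟩
    filter_upwards [(isClosed_tsupport f).isOpen_compl.mem_nhds fun h => ht₀ (hf_supp h)] with t ht
    simpa [e.zeroExtension_eq_zero (image_eq_zero_of_notMem_tsupport ht)] using hε.le

theorem exists_sectionAlgebra_eq_zeroExtension (hU : IsOpen U) {f : Ω → B}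
    (hf : Continuous f) (hf_compact : HasCompactSupport f) (hf_supp : tsupport f ⊆ U) :
    ∃ a : 𝒰.sectionAlgebra, ⇑a.1 = e.zeroExtension f := by
  have hmem := e.zeroExtension_mem hU hf hf_supp
  have hlim : Tendsto (fun t => ‖e.zeroExtension f t‖) (cocompact Ω) (𝓝 0) := by
    refine tendsto_const_nhds.congr' ?_
    filter_upwards [hf_compact.isCompact.compl_mem_cocompact] with t ht
    rw [e.zeroExtension_eq_zero (image_eq_zero_of_notMem_tsupport ht), norm_zero]
  exact ⟨⟨⟨_, 𝒰.memℓp_of_vanishing hmem hlim⟩, hmem, hlim⟩, rfl⟩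

/-- The restriction of sections to a subset of `U`, as functions with values in `B`. -/
noncomputable def restrictTo {Z : Set Ω} (hZU : Z ⊆ U) : 𝒰.sectionAlgebra →L[ℂ] (Z →ᵇ B) :=
  have hbound (a : 𝒰.sectionAlgebra) (t : U) : ‖e.toFun t (a.1 t)‖ ≤ ‖a‖ := by
    rw [LinearIsometryEquiv.norm_map]
    exact lp.norm_apply_le_norm ENNReal.top_ne_zero a.1 t
  LinearMap.mkContinuous
    { toFun a := .ofNormedAddCommGroup (fun t : Z => e.toFun (Set.inclusion hZU t) (a.1 t))
        ((e.continuous_toFun a.2.1).comp (continuous_inclusion hZU)) _ fun t => hbound a _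
      map_add' a b := by
        ext t
        exact map_add (e.toFun (Set.inclusion hZU t)) (a.1 t) (b.1 t)
      map_smul' c a := by
        ext t
        exact map_smul (e.toFun (Set.inclusion hZU t)) c (a.1 t) }
    1 fun a => by
      rw [one_mul]
      exact BoundedContinuousFunction.norm_ofNormedAddCommGroup_le _ (norm_nonneg a)
        fun t => hbound a _

theorem restrictTo_apply {Z : Set Ω} (hZU : Z ⊆ U) (a : 𝒰.sectionAlgebra) (t : Z) :
    e.restrictTo hZU a t = e.toFun (Set.inclusion hZU t) (a.1 t) := rfl

theorem tendsto_restrictTo {Z : Set Ω} (hZ : IsClosed Z) (hZU : Z ⊆ U) (a : 𝒰.sectionAlgebra) :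
    Tendsto (e.restrictTo hZU a) (cocompact Z) (𝓝 0) := by
  refine tendsto_zero_iff_norm_tendsto_zero.2 ?_
  simp only [restrictTo_apply, LinearIsometryEquiv.norm_map]
  exact a.2.2.comp hZ.isClosedEmbedding_subtypeVal.tendsto_cocompact

theorem exists_sectionAlgebra_eq_smul (hU : IsOpen U) (f : compactlySupportedIn U) (b : B) :
    ∃ a : 𝒰.sectionAlgebra, ⇑a.1 = e.zeroExtension fun t => f.1 t • b := by
  have hsupp : tsupport (fun t => f.1 t • b) ⊆ tsupport f.1 := tsupport_smul_subset_left _ _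
  exact e.exists_sectionAlgebra_eq_zeroExtension hU (by fun_prop)
    (f.2.1.of_isClosed_subset (isClosed_tsupport _) hsupp) (hsupp.trans f.2.2)

theorem exists_isCompactlyBounded_mem_nhds [T2Space Ω] [LocallyCompactSpace Ω]
    [∀ t, CompleteSpace (A t)] [∀ t, Nontrivial (A t)] [CompleteSpace B]
    {m : 𝒰.sectionAlgebra →L[ℂ] 𝒰.sectionAlgebra →L[ℂ] 𝒰.sectionAlgebra}
    (hm : IsProjectiveMul m) {mB : B →L[ℂ] B →L[ℂ] B}
    (hassoc : ∀ x y z, mB (mB x y) z = mB x (mB y z))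
    (hmul : ∀ a b (t : U), e.toFun t ((m a b).1 t) = mB (e.toFun t (a.1 t)) (e.toFun t (b.1 t)))
    (hzero : ∀ a b t, a.1 t = 0 → (m a b).1 t = 0)
    (hU : IsOpen U) {Z : Set Ω} (hZ : IsClosed Z) (hZU : Z ⊆ U) :
    ∃ R : SetRel Z Z, IsCompactlyBounded R ∧ ∀ z, R ∈ 𝓝 (z, z) := by
  rcases isEmpty_or_nonempty Z with hempty | hnonempty
  · exact ⟨Set.univ, fun _ _ => ⟨∅, isCompact_empty, fun z => isEmptyElim z⟩, isEmptyElim⟩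
  have : Nontrivial B :=
    hnonempty.elim fun z => (e.toFun (Set.inclusion hZU z)).symm.toEquiv.nontrivial
  have : LocallyCompactSpace Z := hZ.locallyCompactSpace
  choose j hj using e.exists_sectionAlgebra_eq_smul hU
  have hj_toFun (f b) (t : U) : e.toFun t ((j f b).1 t) = f.1 t • b := by simp [hj]
  have hj_eq {a : 𝒰.sectionAlgebra} {f b} (ha : ∀ t : U, e.toFun t (a.1 t) = f.1 t • b)
      (ha_zero : ∀ t ∉ U, a.1 t = 0) : a = j f b :=
    Subtype.ext (lp.ext ((e.eq_zeroExtension_iff.2 ⟨ha, ha_zero⟩).trans (hj f b).symm))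
  have hj_mul (f g x y) : m (j f x) (j g y) = j (f * g) (mB x y) := by
    refine hj_eq (fun t => ?_) fun t ht => hzero _ _ t ?_
    · simp [hmul, hj_toFun, smul_smul, mul_comm]
    · rw [hj, e.zeroExtension_of_notMem _ ht]
  have hj_zero (f) : j f 0 = 0 := (hj_eq (fun t => by simp) fun _ _ => rfl).symm
  have hurysohn (K : Set Z) (hK : IsCompact K) :
      ∃ f : compactlySupportedIn U, ∀ t ∈ K, f.1 t = 1 := by
    obtain ⟨f, hf⟩ := exists_compactlySupportedIn_eq_one (hK.image continuous_subtype_val) hU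
      ((Subtype.coe_image_subset Z K).trans hZU)
    exact ⟨f, fun t ht => hf t (Set.mem_image_of_mem _ ht)⟩
  exact hm.exists_isCompactlyBounded_mem_nhds (r := e.restrictTo hZU) hassoc
    (fun a b t => hmul a b _) (e.tendsto_restrictTo hZ hZU) (c := fun f t => f.1 t) hurysohn
    (fun f b t => hj_toFun f b _) hj_mul hj_zero

end Iso

section

variable [T2Space Ω] [LocallyCompactSpace Ω] [∀ t, IsScalarTower ℂ (A t) (A t)]
  [∀ t, SMulCommClass ℂ (A t) (A t)] [∀ t, CompleteSpace (A t)] [∀ t, Nontrivial (A t)]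

theorem IsTrivial.exists_isCompactlyBounded_mem_nhds {U : Set Ω} (htriv : (𝒰.restrict U).IsTrivial)
    (hproj : IsLeftProjective 𝒰.sectionAlgebra ∨ IsRightProjective 𝒰.sectionAlgebra)
    (hU : IsOpen U) {Z : Set Ω} (hZ : IsClosed Z) (hZU : Z ⊆ U) :
    ∃ R : SetRel Ω Ω, IsCompactlyBounded R ∧ ∀ t, Z ∈ 𝓝 t → R ∈ 𝓝 (t, t) := by
  obtain ⟨B, _, _, _, _, _, ⟨e⟩⟩ := htriv
  obtain ⟨R, hR, hdiag⟩ : ∃ R : SetRel Z Z, IsCompactlyBounded R ∧ ∀ z, R ∈ 𝓝 (z, z) := by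
    rcases hproj with hproj | hproj
    · exact e.exists_isCompactlyBounded_mem_nhds hproj.isProjectiveMul (mB := .mul ℂ B) mul_assoc
        (fun a b t => e.map_mul t _ _)
        (fun a b t ht => mul_eq_zero_of_left ht (b.1 t)) hU hZ hZU
    · exact e.exists_isCompactlyBounded_mem_nhds hproj.isProjectiveMul
        (mB := (ContinuousLinearMap.mul ℂ B).flip) (fun x y z => (mul_assoc z y x).symm)
        (fun a b t => e.map_mul t _ _)
        (fun a b t ht => mul_eq_zero_of_right (b.1 t) ht) hU hZ hZU
  refine ⟨_, hR.image hZ.isClosedEmbedding_subtypeVal, fun t ht => ?_⟩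
  have hrange : Set.range (Prod.map Subtype.val Subtype.val : Z × Z → Ω × Ω) ∈ 𝓝 (t, t) := by
    simpa only [Set.range_prodMap, Subtype.range_coe] using prod_mem_nhds ht ht
  have hmap := (IsEmbedding.subtypeVal.prodMap IsEmbedding.subtypeVal).map_nhds_of_mem
    (⟨t, mem_of_mem_nhds ht⟩, ⟨t, mem_of_mem_nhds ht⟩) hrange
  exact hmap ▸ image_mem_map (hdiag _)

theorem paracompactSpace_of_isSigmaLocallyTrivial {W : Set Ω} (hW : IsClopen W)
    (htriv : (𝒰.restrict W).IsSigmaLocallyTrivial)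
    (hproj : IsLeftProjective 𝒰.sectionAlgebra ∨ IsRightProjective 𝒰.sectionAlgebra) :
    ParacompactSpace W := by
  obtain ⟨𝓒, h𝓒, -, 𝓥, hcountable, h𝓥, hcover⟩ := htriv
  have hW_emb := hW.isClosed.isClosedEmbedding_subtypeVal
  have hrel (V : 𝓥) : ∃ R : SetRel W W, IsCompactlyBounded R ∧ ∀ t ∈ V.1, R ∈ 𝓝 (t, t) := by
    obtain ⟨hV, U, hU, hVU⟩ := h𝓥 V V.2
    obtain ⟨hU_open, hU_triv⟩ := h𝓒 U hU
    obtain ⟨R, hR, hdiag⟩ := hU_triv.of_restrict_restrict.exists_isCompactlyBounded_mem_nhds hproj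
      (hW.isOpen.isOpenMap_subtype_val U hU_open)
      (hW_emb.isClosedMap (closure V.1) isClosed_closure) (Set.image_mono hVU)
    refine ⟨_, hR.preimage hW_emb, fun t ht => ?_⟩
    refine (continuous_subtype_val.prodMap continuous_subtype_val).continuousAt (hdiag t ?_)
    exact hW.isOpen.isOpenMap_subtype_val.image_mem_nhds
      (mem_of_superset (hV.mem_nhds ht) subset_closure)
  choose R hR hdiag using hrel
  have := hcountable.to_subtype
  have := hW.isClosed.locallyCompactSpace
  refine paracompactSpace_of_countable_setRel hR fun t => ?_
  obtain ⟨V, hV, ht⟩ := Set.mem_sUnion.1 (hcover.symm ▸ Set.mem_univ t)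
  exact ⟨⟨V, hV⟩, hdiag ⟨V, hV⟩ t ht⟩

end

end ContinuousField

end Fields

theorem theorem4p6 {Ω : Type u} [TopologicalSpace Ω] [T2Space Ω] [LocallyCompactSpace Ω]
    {A : Ω → Type v} [∀ t, NonUnitalNormedRing (A t)] [∀ t, NormedSpace ℂ (A t)]
    [∀ t, IsScalarTower ℂ (A t) (A t)] [∀ t, SMulCommClass ℂ (A t) (A t)]
    [∀ t, CompleteSpace (A t)] [∀ t, Nontrivial (A t)]
    (𝒰 : ContinuousField A)
    {M : Type w} (W : M → Set Ω) (hW_open : ∀ μ, IsOpen (W μ))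
    (hW_disjoint : Pairwise fun μ ν => Disjoint (W μ) (W ν)) (hW_cover : ⋃ μ, W μ = Set.univ)
    (hW_triv : ∀ μ, (𝒰.restrict (W μ)).IsSigmaLocallyTrivial)
    (hproj : IsLeftProjective 𝒰.sectionAlgebra ∨ IsRightProjective 𝒰.sectionAlgebra) :
    ParacompactSpace Ω :=
  paracompactSpace_of_iUnion_disjoint hW_open hW_disjoint hW_cover fun μ =>
    ContinuousField.paracompactSpace_of_isSigmaLocallyTrivial
      (isClopen_of_iUnion_disjoint hW_open hW_disjoint hW_cover μ) (hW_triv μ) hproj
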